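/- Let $I$ be a finite set of students and $S$ a finite set of schools. A problem $(P,\succ,q)$ consists of a strict preference relation $P_i$ over $S\cup\{\emptyset\}$ for each student $i$ (a strict total order; $\emptyset$ is the outside option), a strict priority order $\succ_s$ over $I$ and a capacity $q_s\in\mathbb{N}$ for each school $s$. School $s$ is acceptable to $i$ if $s\mathrel{P_i}\emptyset$. A matching is a function $\mu:I\to S\cup\{\emptyset\}$ with $|\mu^{-1}(s)|\le q_s$ for all $s\in S$; a mechanism $\varphi$ assigns a matching to each problem, and $\varphi_i(P,\succ,q)$ denotes the component of student $i$. A matching $\mu$ is stable at $(P,\succ,q)$ if $\mu(i)=\emptyset$ or $\mu(i)\mathrel{P_i}\emptyset$ for every student $i$, and there are no student $i$ and school $s$ such that $s\mathrel{P_i}\mu(i)$ and either $|\mu^{-1}(s)|<q_s$ or $i\succ_s j$ for some $j$ with $\mu(j)=s$. A mechanism $\varphi$ is not manipulable at $(P,\succ,q)$ if there are no student $i$ and preference relation $\hat P_i$ such that $\varphi_i((\hat P_i,P_{-i}),\succ,q)\mathrel{P_i}\varphi_i(P,\succ,q)$. Let $GS$ be the Gale-Shapley mechanism (student-proposing deferred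 acceptance): at each step every student who is not tentatively accepted applies to her most-preferred acceptable school that has not yet rejected her (if any); each school $s$ considers its tentatively accepted students together with its new applicants, tentatively accepts the (up to) $q_s$ of highest priority and rejects the others; when no student is rejected, the tentative acceptances become final. Let $\beta$ be the Boston mechanism (immediate acceptance), defined in the same way except that acceptances are final at once: at each step each school accepts its new applicants of highest priority up to its remaining capacity and rejects the others. In both mechanisms students who are never finally accepted get $\emptyset$. For a natural number $k$, let $P_i^k$ be the preference relation that orders the schools as $P_i$ does and whose acceptable schools are exactly the first $\min(x,k)$ acceptable schools of $P_i$, where $x$ is the number of acceptable schools under $P_i$; let $P^k=(P_i^k)_{i\in I}$, and define the constrained mechanisms by $\beta^k(P,\succ,q)=\beta(P^k,\succ,q)$ and $GS^k(P,\succ,q)=GS(P^k,\succ,q)$. Let $(P,\succ,q)$ be a problem and let $k>1$. (i) If $\beta^k$ is not manipulable at $(P,\succ,q)$, then the matching $\beta^k(P,\succ,q)$ is stable at $(P,\succ,q)$. (ii) If the matching $GS^k(P,\succ,q)$ is stable at $(P,\succ,q)$, then $GS^k$ is not manipulable at $(P,\succ,q)$. -/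

import Mathlib

namespace SchoolChoice

/-- A strict (total) order on `α`: `r a b` reads "`a` is ranked strictly above `b`". -/
structure Ranking (α : Type*) where
  r : α → α → Prop
  irrefl : ∀ a, ¬ r a a
  trans : ∀ a b c, r a b → r b c → r a c
  total : ∀ a b, a ≠ b → r a b ∨ r b a

/-- A problem `(P, ≻, q)` with students `I` and schools `S`. The outside option of every
student is `none : Option S`. -/
structure Problem (I S : Type*) where
  /-- `P i` is the strict preference relation of student `i` over schools and outside option. -/
  P : I → Ranking (Option S)
  /-- `prio s` is the strict priority order of school `s`. -/
  prio : S → Ranking I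
  /-- `q s` is the capacity of school `s`. -/
  q : S → ℕ

open Classical in
/-- A matching for the capacity vector `q`. -/
structure Matching (I : Type*) {S : Type*} [Fintype I] (q : S → ℕ) where
  toFun : I → Option S
  capacity : ∀ s, (Finset.univ.filter fun i => toFun i = some s).card ≤ q s

section Stability

variable {I S : Type*} [Fintype I]

/-- `μ i R_i ∅` for every student `i`. -/
def IndividuallyRational (p : Problem I S) (μ : Matching I p.q) : Prop :=
  ∀ i, (p.P i).r (μ.toFun i) none ∨ μ.toFun i = none

open Classical in
/-- The pair `(i, s)` blocks `μ`. -/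
def Blocks (p : Problem I S) (μ : Matching I p.q) (i : I) (s : S) : Prop :=
  (p.P i).r (some s) (μ.toFun i) ∧
    ((∃ j, μ.toFun j = some s ∧ (p.prio s).r i j) ∨
      (Finset.univ.filter fun j => μ.toFun j = some s).card < p.q s)

def BlockingStudent (p : Problem I S) (μ : Matching I p.q) (i : I) : Prop :=
  ∃ s, Blocks p μ i s

def Stable (p : Problem I S) (μ : Matching I p.q) : Prop :=
  IndividuallyRational p μ ∧ ¬ ∃ i, BlockingStudent p μ i

end Stability

/-- A mechanism maps each problem to a matching. -/
def Mechanism (I S : Type*) [Fintype I] := (p : Problem I S) → Matching I p.q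

open Classical in
/-- The problem in which student `i` reports `Q` and everything else is unchanged. -/
noncomputable def Problem.misreport {I S : Type*} (p : Problem I S) (i : I)
    (Q : Ranking (Option S)) : Problem I S :=
  { p with P := Function.update p.P i Q }

/-- Student `i` is a manipulating student of `φ` at `p`. -/
def ManipulatingStudent {I S : Type*} [Fintype I] (φ : Mechanism I S) (p : Problem I S)
    (i : I) : Prop :=
  ∃ Q : Ranking (Option S), (p.P i).r ((φ (p.misreport i Q)).toFun i) ((φ p).toFun i)

def NotManipulable {I S : Type*} [Fintype I] (φ : Mechanism I S) (p : Problem I S) : Prop :=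
  ¬ ∃ i, ManipulatingStudent φ p i

/-! ### Constrained mechanisms -/

open Classical in
/-- `s` is among the first `k` acceptable schools of the preference relation `Q`. -/
def AmongFirst {S : Type*} [Fintype S] (Q : Ranking (Option S)) (k : ℕ) (s : S) : Prop :=
  Q.r (some s) none ∧ (Finset.univ.filter fun t : S => Q.r (some t) (some s)).card < k

/-- The truncated relation: schools are ordered as in `Q`, and exactly the first `k` acceptable
schools of `Q` (all of them if there are fewer than `k`) are ranked above the outside option. -/
def truncRel {S : Type*} [Fintype S] (Q : Ranking (Option S)) (k : ℕ) :
    Option S → Option S → Prop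
  | some s, some t => Q.r (some s) (some t)
  | some s, none => AmongFirst Q k s
  | none, some t => ¬ AmongFirst Q k t
  | none, none => False

theorem AmongFirst.of_above {S : Type*} [Fintype S] {Q : Ranking (Option S)} {k : ℕ} {s t : S}
    (h : AmongFirst Q k s) (hts : Q.r (some t) (some s)) : AmongFirst Q k t := by
  refine ⟨Q.trans _ _ _ hts h.1, lt_of_le_of_lt (Finset.card_le_card ?_) h.2⟩
  intro u hu
  simp only [Finset.mem_filter, Finset.mem_univ, true_and] at hu ⊢
  exact Q.trans _ _ _ hu hts

/-- The truncation of a preference relation after the `k`-th acceptable school. -/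
def Ranking.trunc {S : Type*} [Fintype S] (Q : Ranking (Option S)) (k : ℕ) :
    Ranking (Option S) where
  r := truncRel Q k
  irrefl := by
    rintro (_ | s)
    · exact id
    · exact Q.irrefl _
  trans := by
    rintro (_ | a) (_ | b) (_ | c) h1 h2
    · exact h1
    · exact absurd h1 id
    · exact absurd h2 h1
    · exact fun h => h1 (h.of_above h2)
    · exact h1
    · by_cases hac : a = c
      · subst hac
        exact absurd h1 h2
      · rcases Q.total (some a) (some c) (by simpa using hac) with h | h
        · exact h
        · exact absurd (AmongFirst.of_above h1 h) h2
    · exact AmongFirst.of_above h2 h1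
    · exact Q.trans _ _ _ h1 h2
  total := by
    rintro (_ | a) (_ | b) hab
    · exact absurd rfl hab
    · exact (em (AmongFirst Q k b)).symm
    · exact em (AmongFirst Q k a)
    · exact Q.total _ _ hab

/-- The problem `(P^k, ≻, q)`. -/
def Problem.trunc {I S : Type*} [Fintype S] (p : Problem I S) (k : ℕ) : Problem I S :=
  { p with P := fun i => (p.P i).trunc k }

/-- The constrained version `φ^k` of a mechanism: `φ^k(P, ≻, q) = φ(P^k, ≻, q)`. -/
def Mechanism.constrained {I S : Type*} [Fintype I] [Fintype S] (φ : Mechanism I S) (k : ℕ) :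
    Mechanism I S :=
  fun p => ⟨(φ (p.trunc k)).toFun, (φ (p.trunc k)).capacity⟩

/-! ### The two algorithms -/

open Classical in
/-- The `min n |A|` highest-ranked elements of `A`: those with fewer than `n` elements of `A`
above them. -/
noncomputable def highest {I : Type*} (ρ : Ranking I) (n : ℕ) (A : Finset I) : Finset I :=
  A.filter fun i => (A.filter fun j => ρ.r j i).card < n

theorem exists_lowest {I : Type*} (ρ : Ranking I) (T : Finset I) (hT : T.Nonempty) :
    ∃ i ∈ T, ∀ j ∈ T, j ≠ i → ρ.r j i := by
  classical
  induction hT using Finset.Nonempty.cons_induction with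
  | singleton a => exact ⟨a, by simp, by simp⟩
  | cons a s ha hs ih =>
    obtain ⟨i, hi, hlow⟩ := ih
    have hai : a ≠ i := fun h => ha (h ▸ hi)
    rcases ρ.total a i hai with h | h
    · refine ⟨i, by simp [hi], fun j hj hji => ?_⟩
      rcases Finset.mem_cons.1 hj with rfl | hj
      · exact h
      · exact hlow j hj hji
    · refine ⟨a, by simp, fun j hj hja => ?_⟩
      rcases Finset.mem_cons.1 hj with rfl | hj
      · exact absurd rfl hja
      · by_cases hji : j = i
        · exact hji ▸ h
        · exact ρ.trans _ _ _ (hlow j hj hji) h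

theorem card_highest_le {I : Type*} (ρ : Ranking I) (n : ℕ) (A : Finset I) :
    (highest ρ n A).card ≤ n := by
  classical
  rcases (highest ρ n A).eq_empty_or_nonempty with h | h
  · simp [h]
  · obtain ⟨i, hi, hlow⟩ := exists_lowest ρ _ h
    have hlt : (A.filter fun j => ρ.r j i).card < n := by
      have := (Finset.mem_filter.1 hi).2
      convert this
    have hsub : (highest ρ n A).erase i ⊆ A.filter fun j => ρ.r j i := by
      intro j hj
      obtain ⟨hji, hj⟩ := Finset.mem_erase.1 hj
      exact Finset.mem_filter.2 ⟨(Finset.mem_filter.1 hj).1, hlow j hj hji⟩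
    have h1 := Finset.card_le_card hsub
    have h2 := Finset.card_erase_add_one hi
    omega

/-- The state of an algorithm after a step: `acc s` is the set of students whom school `s` has
accepted (tentatively in Gale-Shapley, finally in Boston), and `rej s` is the set of students
whom `s` has rejected so far. -/
structure State (I S : Type*) where
  acc : S → Finset I
  rej : S → Finset I

/-- Nobody has applied anywhere yet. -/
def State.init (I S : Type*) : State I S := ⟨fun _ => ∅, fun _ => ∅⟩

section Algorithms

variable {I S : Type*} [Fintype I]

/-- `s` is the most-preferred acceptable school of `i` among those which have not yet rejected
`i`. -/
def IsNextChoice (p : Problem I S) (σ : State I S) (i : I) (s : S) : Prop :=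
  (p.P i).r (some s) none ∧ i ∉ σ.rej s ∧
    ∀ t, t ≠ s → (p.P i).r (some t) none → i ∉ σ.rej t → (p.P i).r (some s) (some t)

open Classical in
/-- The new applicants of school `s`: students who are not currently accepted at any school
(at the first step, all students; later, those who have just been rejected) apply to their most
preferred acceptable school which has not yet rejected them, if there is any. -/
noncomputable def applicants (p : Problem I S) (σ : State I S) (s : S) : Finset I :=
  Finset.univ.filter fun i => (∀ t, i ∉ σ.acc t) ∧ IsNextChoice p σ i s

open Classical in
/-- A step of student-proposing deferred acceptance: each school `s` considers the students it
has tentatively accepted together with its new applicants, tentatively accepts the `q s` of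
highest priority and rejects the others. -/
noncomputable def gsStep (p : Problem I S) (σ : State I S) : State I S where
  acc s := highest (p.prio s) (p.q s) (σ.acc s ∪ applicants p σ s)
  rej s := σ.rej s ∪ ((σ.acc s ∪ applicants p σ s) \
    highest (p.prio s) (p.q s) (σ.acc s ∪ applicants p σ s))

open Classical in
/-- A step of immediate acceptance: each school `s` finally accepts its new applicants of
highest priority up to its remaining capacity `q s - |acc s|` and rejects the others. -/
noncomputable def bostonStep (p : Problem I S) (σ : State I S) : State I S where
  acc s := σ.acc s ∪ highest (p.prio s) (p.q s - (σ.acc s).card) (applicants p σ s)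
  rej s := σ.rej s ∪ (applicants p σ s \
    highest (p.prio s) (p.q s - (σ.acc s).card) (applicants p σ s))

noncomputable def gsState (p : Problem I S) (t : ℕ) : State I S :=
  (gsStep p)^[t] (State.init I S)

noncomputable def bostonState (p : Problem I S) (t : ℕ) : State I S :=
  (bostonStep p)^[t] (State.init I S)

theorem card_gsState_acc_le (p : Problem I S) (t : ℕ) (s : S) :
    ((gsState p t).acc s).card ≤ p.q s := by
  cases t with
  | zero => simp [gsState, State.init]
  | succ t =>
    rw [gsState, Function.iterate_succ_apply']
    exact card_highest_le _ _ _

theorem card_bostonState_acc_le (p : Problem I S) (t : ℕ) (s : S) :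
    ((bostonState p t).acc s).card ≤ p.q s := by
  classical
  induction t with
  | zero => simp [bostonState, State.init]
  | succ t ih =>
    rw [bostonState, Function.iterate_succ_apply']
    change ((bostonState p t).acc s ∪ highest (p.prio s)
      (p.q s - ((bostonState p t).acc s).card) (applicants p (bostonState p t) s)).card ≤ p.q s
    have h1 := card_highest_le (p.prio s) (p.q s - ((bostonState p t).acc s).card)
      (applicants p (bostonState p t) s)
    have h2 := Finset.card_union_le ((bostonState p t).acc s) (highest (p.prio s)
      (p.q s - ((bostonState p t).acc s).card) (applicants p (bostonState p t) s))
    omega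

open Classical in
/-- The assignment recorded in a state: `i` gets the school which has accepted her, and the
outside option if there is none. -/
noncomputable def State.assignment (σ : State I S) (i : I) : Option S :=
  if h : ∃ s, i ∈ σ.acc s then some h.choose else none

open Classical in
theorem State.card_assignment_le (σ : State I S) (q : S → ℕ) (h : ∀ s, (σ.acc s).card ≤ q s)
    (s : S) : (Finset.univ.filter fun i => σ.assignment i = some s).card ≤ q s := by
  refine le_trans (Finset.card_le_card ?_) (h s)
  intro i hi
  have hi := (Finset.mem_filter.1 hi).2
  unfold State.assignment at hi
  split_ifs at hi with hex
  · have := hex.choose_spec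
    rwa [Option.some.inj hi] at this

variable [Fintype S]

/-- The number of steps for which both algorithms are run. Every step at which somebody is
rejected adds a new (student, school) pair to the record of rejections, so after at most
`|I| * |S| + 1` steps a step without rejection has occurred, and from then on the state does not
change (`gsStep_stop` and `bostonStep_stop` below). -/
def numSteps (I S : Type*) [Fintype I] [Fintype S] : ℕ :=
  Fintype.card I * Fintype.card S + 1

/-- The Gale-Shapley mechanism `GS`. -/
noncomputable def GS (I S : Type*) [Fintype I] [Fintype S] : Mechanism I S := fun p =>
  ⟨(gsState p (numSteps I S)).assignment,
    State.card_assignment_le _ _ (card_gsState_acc_le p _)⟩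

/-- The Boston mechanism `β`. -/
noncomputable def boston (I S : Type*) [Fintype I] [Fintype S] : Mechanism I S := fun p =>
  ⟨(bostonState p (numSteps I S)).assignment,
    State.card_assignment_le _ _ (card_bostonState_acc_le p _)⟩

end Algorithms

theorem iterate_stop {α : Type*} (f : α → α) (m : α → ℕ) (Inv : α → Prop) (N : ℕ)
    (hInv : ∀ x, Inv x → Inv (f x)) (hm : ∀ x, m x ≤ N)
    (hf : ∀ x, Inv x → m x < m (f x) ∨ f (f x) = f x) (x : α) (hx : Inv x) :
    f (f^[N + 1] x) = f^[N + 1] x := by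
  have hI : ∀ t, Inv (f^[t] x) := by
    intro t
    induction t with
    | zero => exact hx
    | succ t ih => rw [Function.iterate_succ_apply']; exact hInv _ ih
  have key : ∀ t, t ≤ m (f^[t] x) ∨ f (f^[t] x) = f^[t] x := by
    intro t
    induction t with
    | zero => exact Or.inl (Nat.zero_le _)
    | succ t ih =>
      rw [Function.iterate_succ_apply']
      rcases ih with ih | ih
      · rcases hf _ (hI t) with h | h
        · left; omega
        · exact Or.inr h
      · right; rw [ih, ih]
  rcases key (N + 1) with h | h
  · exact absurd (hm (f^[N + 1] x)) (by omega)
  · exact h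

theorem highest_eq_self {I : Type*} (ρ : Ranking I) (n : ℕ) (A : Finset I) (h : A.card ≤ n) :
    highest ρ n A = A := by
  classical
  refine Finset.filter_true_of_mem fun i hi => lt_of_lt_of_le (Finset.card_lt_card ?_) h
  refine Finset.filter_ssubset.2 ⟨i, hi, ρ.irrefl i⟩

/-- Number of rejections recorded in a state. -/
def State.numRej {I S : Type*} [Fintype S] (σ : State I S) : ℕ := ∑ s, (σ.rej s).card

theorem State.numRej_le {I S : Type*} [Fintype I] [Fintype S] (σ : State I S) :
    σ.numRej ≤ Fintype.card I * Fintype.card S := by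
  unfold State.numRej
  refine (Finset.sum_le_card_nsmul _ _ (Fintype.card I)
    fun s _ => Finset.card_le_univ _).trans ?_
  simp [mul_comm]

theorem State.numRej_lt_or {I S : Type*} [Fintype S] {σ τ : State I S}
    (h : ∀ s, σ.rej s ⊆ τ.rej s) : σ.numRej < τ.numRej ∨ τ.rej = σ.rej := by
  by_cases heq : τ.rej = σ.rej
  · exact Or.inr heq
  · left
    obtain ⟨s, hs⟩ := Function.ne_iff.1 heq
    exact Finset.sum_lt_sum (fun s _ => Finset.card_le_card (h s))
      ⟨s, Finset.mem_univ s, Finset.card_lt_card ((h s).ssubset_of_ne (Ne.symm hs))⟩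

theorem isNextChoice_congr {I S : Type*} {p : Problem I S} {σ τ : State I S}
    (h : τ.rej = σ.rej) (i : I) (s : S) : IsNextChoice p τ i s ↔ IsNextChoice p σ i s := by
  unfold IsNextChoice
  rw [h]

theorem mem_applicants {I S : Type*} [Fintype I] {p : Problem I S} {σ : State I S} {s : S} {i : I} :
    i ∈ applicants p σ s ↔ (∀ t, i ∉ σ.acc t) ∧ IsNextChoice p σ i s := by
  simp [applicants]

theorem applicants_eq_empty {I S : Type*} [Fintype I] {p : Problem I S} {σ τ : State I S}
    (hrej : τ.rej = σ.rej) (hacc : ∀ s, σ.acc s ⊆ τ.acc s)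
    (happ : ∀ s, applicants p σ s ⊆ τ.acc s) (s : S) : applicants p τ s = ∅ := by
  classical
  refine Finset.eq_empty_of_forall_notMem fun i hi => ?_
  obtain ⟨hno, hnext⟩ := mem_applicants.1 hi
  refine hno s (happ s (mem_applicants.2 ⟨fun t ht => hno t (hacc t ht), ?_⟩))
  exact (isNextChoice_congr hrej i s).1 hnext

/-- After `numSteps` steps of the Gale-Shapley algorithm nothing changes any more. -/
theorem gsStep_stop {I S : Type*} [Fintype I] [Fintype S] (p : Problem I S) :
    gsStep p (gsState p (numSteps I S)) = gsState p (numSteps I S) := by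
  classical
  refine iterate_stop (gsStep p) State.numRej (fun σ => ∀ s, ∀ i ∈ σ.acc s, i ∉ σ.rej s) _
    ?_ State.numRej_le ?_ _ (by simp [State.init])
  · intro σ hσ s i hi hr
    have hi' := (Finset.mem_filter.1 hi).1
    rcases Finset.mem_union.1 hr with hr | hr
    · rcases Finset.mem_union.1 hi' with h | h
      · exact hσ s i h hr
      · exact (mem_applicants.1 h).2.2.1 hr
    · exact (Finset.mem_sdiff.1 hr).2 (by simpa [gsStep] using hi)
  · intro σ hσ
    refine (State.numRej_lt_or (σ := σ) (τ := gsStep p σ) fun s i hi => ?_).imp id fun hrej => ?_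
    · exact Finset.mem_union_left _ hi
    · have hall : ∀ s, σ.acc s ∪ applicants p σ s ⊆ (gsStep p σ).acc s := by
        intro s i hi
        by_contra hn
        have hr : i ∈ (gsStep p σ).rej s :=
          Finset.mem_union_right _ (Finset.mem_sdiff.2 ⟨by simpa using hi, by simpa [gsStep] using hn⟩)
        rw [hrej] at hr
        rcases Finset.mem_union.1 hi with h | h
        · exact hσ s i h hr
        · exact (mem_applicants.1 h).2.2.1 hr
      have happ := applicants_eq_empty (p := p) hrej
        (fun s => Finset.union_subset_left (hall s)) (fun s => Finset.union_subset_right (hall s))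
      have hhigh : ∀ s, highest (p.prio s) (p.q s) ((gsStep p σ).acc s) = (gsStep p σ).acc s :=
        fun s => highest_eq_self _ _ _ (card_highest_le _ _ _)
      generalize gsStep p σ = τ at happ hhigh
      simp [gsStep, happ, hhigh]

/-- After `numSteps` steps of the Boston algorithm nothing changes any more. -/
theorem bostonStep_stop {I S : Type*} [Fintype I] [Fintype S] (p : Problem I S) :
    bostonStep p (bostonState p (numSteps I S)) = bostonState p (numSteps I S) := by
  classical
  refine iterate_stop (bostonStep p) State.numRej (fun _ => True) _
    (fun _ _ => trivial) State.numRej_le ?_ _ trivial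
  intro σ _
  refine (State.numRej_lt_or (σ := σ) (τ := bostonStep p σ) fun s i hi => ?_).imp id fun hrej => ?_
  · exact Finset.mem_union_left _ hi
  · have hall : ∀ s, applicants p σ s ⊆ (bostonStep p σ).acc s := by
      intro s i hi
      by_contra hn
      have hr : i ∈ (bostonStep p σ).rej s :=
        Finset.mem_union_right _ (Finset.mem_sdiff.2
          ⟨hi, fun h => hn (Finset.mem_union_right _ (by convert h))⟩)
      rw [hrej] at hr
      exact (mem_applicants.1 hi).2.2.1 hr
    have happ := applicants_eq_empty (p := p) hrej
      (fun s => Finset.subset_union_left) hall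
    have hempty : ∀ (ρ : Ranking I) n, highest ρ n ∅ = ∅ := fun ρ n =>
      highest_eq_self ρ n ∅ (by simp)
    generalize bostonStep p σ = τ at happ
    simp [bostonStep, happ, hempty]

end SchoolChoice

namespace SchoolChoice

/-! ### Strict orders and the choice of the `n` best elements. -/

section Rankings

variable {α : Type*}

/-! (i) Let `(i, s)` block the Boston outcome, and let `i` report `s` first. Her rivals at `s` in
step one are exactly the others who apply there first anyway. Were she rejected, at least `q s`
first-step applicants of higher priority would exist; under the truthful report such students fill
`s` at once and for good, which excludes both a free seat and a lower-priority student at `s`. So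
the report wins `s` (`boston_misreport_eq_some`), and truncation keeps `s` since it comes first.

(ii) The tools are three classical facts on deferred acceptance: student-optimality (`GS_optimal`),
equality of the sets of unmatched students in all stable matchings (`GS_eq_none_iff`), and, from
these two, strategy-proofness (`notManipulable_GS`). Let `μ` be the outcome at `P^k`, stable at `P`.
For a student `i`, take the intermediate profile where `i` reports the full `P i` and the others
their truncations. There `μ` is still stable, and deferred acceptance gives `i` nothing better than
`μ i`: if `μ i` is `none`, she stays unmatched; otherwise a better school also lies among her first
`k`, so the new matching would be stable at `P^k` and contradict the optimality of `μ`. Hence a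
profitable constrained report would be a profitable manipulation of unconstrained `GS` at the
intermediate profile. -/

theorem Ranking.asymm (ρ : Ranking α) {a b : α} (h : ρ.r a b) : ¬ ρ.r b a :=
  fun h' => ρ.irrefl a (ρ.trans _ _ _ h h')

theorem Ranking.of_not_of_rel (ρ : Ranking α) {a b c : α} (h : ¬ ρ.r b c) (hac : ρ.r a c) :
    ρ.r a b := by
  by_cases hbc : b = c
  · exact hbc ▸ hac
  · rcases ρ.total b c hbc with h' | h'
    · exact absurd h' h
    · exact ρ.trans _ _ _ hac h'

/-- Rank first by the class `c` (smaller is better), and then by `ρ`. -/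
def Ranking.refineBy (ρ : Ranking α) (c : α → ℕ) : Ranking α where
  r a b := c a < c b ∨ c a = c b ∧ ρ.r a b
  irrefl a h := by
    rcases h with h | h
    · exact lt_irrefl _ h
    · exact ρ.irrefl a h.2
  trans a b d h h' := by
    rcases h with h | h <;> rcases h' with h' | h'
    · left; omega
    · left; omega
    · left; omega
    · exact Or.inr ⟨h.1.trans h'.1, ρ.trans _ _ _ h.2 h'.2⟩
  total a b hab := by
    rcases lt_trichotomy (c a) (c b) with h | h | h
    · exact Or.inl (Or.inl h)
    · exact (ρ.total a b hab).imp (fun h' => Or.inr ⟨h, h'⟩) fun h' => Or.inr ⟨h.symm, h'⟩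
    · exact Or.inr (Or.inl h)

/-- The dual ranking. -/
def Ranking.rev (ρ : Ranking α) : Ranking α where
  r a b := ρ.r b a
  irrefl := ρ.irrefl
  trans a b c h h' := ρ.trans c b a h' h
  total a b h := (ρ.total a b h).symm

theorem mem_highest {ρ : Ranking α} {n : ℕ} {A : Finset α} {i : α} [DecidablePred (ρ.r · i)] :
    i ∈ highest ρ n A ↔ i ∈ A ∧ (A.filter fun j => ρ.r j i).card < n := by
  classical
  rw [highest, Finset.mem_filter]
  refine and_congr_right fun _ => ?_
  convert Iff.rfl

theorem highest_subset (ρ : Ranking α) (n : ℕ) (A : Finset α) : highest ρ n A ⊆ A :=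
  Finset.filter_subset _ _

/-- Induction on `A`: while `A` has more than `n` elements, deleting the lowest one changes no upper
set of the remaining elements. -/
theorem le_card_highest (ρ : Ranking α) (n : ℕ) (A : Finset α) (h : n ≤ A.card) :
    n ≤ (highest ρ n A).card := by
  classical
  induction hm : A.card generalizing A with
  | zero => omega
  | succ m ih =>
    rcases h.eq_or_lt with h | h
    · rw [highest_eq_self _ _ _ h.ge]; exact h.le
    · obtain ⟨x, hx, hlow⟩ := exists_lowest ρ A (Finset.card_pos.1 (by omega))
      have hc := Finset.card_erase_add_one hx
      refine (ih (A.erase x) (by omega) (by omega)).trans (Finset.card_le_card fun i hi => ?_)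
      rw [mem_highest] at hi ⊢
      obtain ⟨hix, hiA⟩ := Finset.mem_erase.1 hi.1
      refine ⟨hiA, lt_of_le_of_lt (Finset.card_le_card fun j hj => ?_) hi.2⟩
      rw [Finset.mem_filter] at hj ⊢
      refine ⟨Finset.mem_erase.2 ⟨?_, hj.1⟩, hj.2⟩
      rintro rfl
      exact ρ.asymm (hlow i hiA hix) hj.2

open Classical in
/-- If at least `n` elements of `A` are above `i`, then `highest ρ n A` has `n` elements, all of
them above `i`. -/
theorem highest_above {ρ : Ranking α} {n : ℕ} {A : Finset α} {i : α}
    (h : n ≤ (A.filter fun j => ρ.r j i).card) :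
    n ≤ (highest ρ n A).card ∧ ∀ j ∈ highest ρ n A, ρ.r j i := by
  refine ⟨le_card_highest _ _ _ (h.trans (Finset.card_le_card (Finset.filter_subset _ _))),
    fun j hj => ?_⟩
  by_contra hji
  rw [mem_highest] at hj
  refine absurd (h.trans (Finset.card_le_card fun l hl => ?_)) (not_le.2 hj.2)
  rw [Finset.mem_filter] at hl ⊢
  exact ⟨hl.1, ρ.of_not_of_rel hji hl.2⟩

end Rankings

/-! ### Next choices, assignments and misreports. -/

section Algorithms

variable {I S : Type*}

theorem IsNextChoice.unique {p : Problem I S} {σ : State I S} {i : I} {s t : S}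
    (hs : IsNextChoice p σ i s) (ht : IsNextChoice p σ i t) : s = t := by
  by_contra hst
  exact (p.P i).asymm (hs.2.2 t (Ne.symm hst) ht.1 ht.2.1) (ht.2.2 s hst hs.1 hs.2.1)

theorem exists_isNextChoice [Fintype S] {p : Problem I S} {σ : State I S} {i : I} {s : S}
    (hs : (p.P i).r (some s) none) (hr : i ∉ σ.rej s) : ∃ t, IsNextChoice p σ i t := by
  classical
  -- The lowest element of the reversed ranking is the favourite among the schools still open to
  -- `i`.
  obtain ⟨x, hx, htop⟩ := exists_lowest (p.P i).rev
    ((Finset.univ.filter fun t : S => (p.P i).r (some t) none ∧ i ∉ σ.rej t).image some)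
    ⟨some s, by simp [hs, hr]⟩
  obtain ⟨t, ht, rfl⟩ := Finset.mem_image.1 hx
  have ht := (Finset.mem_filter.1 ht).2
  exact ⟨t, ht.1, ht.2, fun u hut hu hur => htop (some u) (by simp [hu, hur]) (by simpa using hut)⟩

theorem State.assignment_eq_some_iff {σ : State I S}
    (h : ∀ i s t, i ∈ σ.acc s → i ∈ σ.acc t → s = t) {i : I} {s : S} :
    σ.assignment i = some s ↔ i ∈ σ.acc s := by
  unfold State.assignment
  split_ifs with hex
  · rw [Option.some.injEq]
    exact ⟨fun hs => hs ▸ hex.choose_spec, fun hs => h _ _ _ hex.choose_spec hs⟩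
  · simp only [false_iff]
    exact fun hs => hex ⟨s, hs⟩

@[simp]
theorem misreport_P_self (p : Problem I S) (i : I) (Q : Ranking (Option S)) :
    (p.misreport i Q).P i = Q := by
  simp [Problem.misreport]

theorem misreport_P_of_ne (p : Problem I S) {i j : I} (h : j ≠ i) (Q : Ranking (Option S)) :
    (p.misreport i Q).P j = p.P j := by
  simp [Problem.misreport, h]

theorem misreport_self (p : Problem I S) (i : I) : p.misreport i (p.P i) = p := by
  simp [Problem.misreport]

/-- The inner report `R` is overwritten, hence arbitrary: it serves to choose the base profile from
which the truncated report counts as a deviation. -/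
theorem trunc_misreport [Fintype S] (p : Problem I S) (k : ℕ) (i : I) (Q R : Ranking (Option S)) :
    (p.misreport i Q).trunc k = ((p.trunc k).misreport i R).misreport i (Q.trunc k) := by
  classical
  simp only [Problem.trunc, Problem.misreport, Problem.mk.injEq, and_true]
  funext j
  by_cases hj : j = i
  · subst hj; simp
  · simp [hj]

variable [Fintype I]

/-! ### Deferred acceptance: stability, student-optimality, unmatched students. -/

section GaleShapley

theorem gsState_succ (p : Problem I S) (t : ℕ) :
    gsState p (t + 1) = gsStep p (gsState p t) :=
  Function.iterate_succ_apply' _ _ _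

open Classical in
theorem mem_gsStep_rej {p : Problem I S} {σ : State I S} {i : I} {s : S}
    (h : i ∈ (gsStep p σ).rej s) : i ∈ σ.rej s ∨
      (i ∈ σ.acc s ∪ applicants p σ s ∧
        p.q s ≤ ((σ.acc s ∪ applicants p σ s).filter fun j => (p.prio s).r j i).card) := by
  refine (Finset.mem_union.1 h).imp id fun h => ?_
  rw [Finset.mem_sdiff, mem_highest] at h
  have h1 : i ∈ σ.acc s ∪ applicants p σ s := by convert h.1
  exact ⟨h1, by simpa [h1] using h.2⟩

theorem isNextChoice_of_mem_gsState_acc (p : Problem I S) (t : ℕ) {i : I} {s : S}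
    (h : i ∈ (gsState p t).acc s) : IsNextChoice p (gsState p t) i s := by
  classical
  induction t generalizing i s with
  | zero => simp [gsState, State.init] at h
  | succ t ih =>
    rw [gsState_succ] at h ⊢
    have hB := highest_subset _ _ _ h
    have hn : IsNextChoice p (gsState p t) i s := by
      rcases Finset.mem_union.1 hB with h' | h'
      · exact ih h'
      · exact (mem_applicants.1 h').2
    refine ⟨hn.1, fun hr => ?_, fun u hu hacc hr => hn.2.2 u hu hacc fun hr' =>
      hr (Finset.mem_union_left _ hr')⟩
    rcases mem_gsStep_rej hr with hr | hr
    · exact hn.2.1 hr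
    · exact absurd (mem_highest.1 h).2 (by simpa using hr.2)

/-- A school rejects only when it is full of better students, and its tentative set only improves
afterwards. -/
theorem gsState_rej_full (p : Problem I S) (t : ℕ) {i : I} {s : S}
    (h : i ∈ (gsState p t).rej s) : p.q s ≤ ((gsState p t).acc s).card ∧
      ∀ j ∈ (gsState p t).acc s, (p.prio s).r j i := by
  classical
  induction t generalizing i s with
  | zero => simp [gsState, State.init] at h
  | succ t ih =>
    rw [gsState_succ] at h ⊢
    have key : p.q s ≤ (((gsState p t).acc s ∪ applicants p (gsState p t) s).filter
        fun j => (p.prio s).r j i).card := by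
      rcases mem_gsStep_rej h with h | h
      · refine (ih h).1.trans (Finset.card_le_card fun j hj => ?_)
        exact Finset.mem_filter.2 ⟨Finset.mem_union_left _ hj, (ih h).2 j hj⟩
      · simpa using h.2
    simpa [gsStep] using highest_above key

/-- The induction behind optimality: at the first rejection of a student by her `ν`-school, some
student preferred by that school would block `ν` with it. -/
theorem gsState_rej_not_stable (p : Problem I S) {ν : Matching I p.q} (hν : Stable p ν) (t : ℕ)
    {i : I} {s : S} (h : i ∈ (gsState p t).rej s) : ν.toFun i ≠ some s := by
  classical
  induction t generalizing i s with
  | zero => simp [gsState, State.init] at h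
  | succ t ih =>
    rw [gsState_succ] at h
    rcases mem_gsStep_rej h with h | ⟨-, h⟩
    · exact ih h
    intro hi
    -- At least `q s` contenders outrank `i`; together with `i` they do not all fit into `s` under
    -- `ν`.
    obtain ⟨j, hj, hjs⟩ : ∃ j ∈ ((gsState p t).acc s ∪ applicants p (gsState p t) s).filter
        (fun j => (p.prio s).r j i), ν.toFun j ≠ some s := by
      by_contra! hall
      have hlt : (((gsState p t).acc s ∪ applicants p (gsState p t) s).filter
          fun j => (p.prio s).r j i).card <
          (Finset.univ.filter fun j => ν.toFun j = some s).card := by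
        refine Finset.card_lt_card ((Finset.ssubset_iff_of_subset fun j hj => ?_).2 ⟨i, ?_, ?_⟩)
        · simpa using hall j hj
        · simpa using hi
        · exact fun hi' => (p.prio s).irrefl i (Finset.mem_filter.1 hi').2
      have hcap : (Finset.univ.filter fun j => ν.toFun j = some s).card ≤ p.q s := by
        convert ν.capacity s
      have h' : p.q s ≤ (((gsState p t).acc s ∪ applicants p (gsState p t) s).filter
          fun j => (p.prio s).r j i).card := by simpa using h
      omega
    obtain ⟨hjB, hji⟩ := Finset.mem_filter.1 hj
    have hn : IsNextChoice p (gsState p t) j s := by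
      rcases Finset.mem_union.1 hjB with h' | h'
      · exact isNextChoice_of_mem_gsState_acc p t h'
      · exact (mem_applicants.1 h').2
    -- By induction the `ν`-school of `j` has not rejected `j`, so it lies below her current choice
    -- `s`.
    refine hν.2 ⟨j, s, ?_, Or.inl ⟨i, hi, hji⟩⟩
    cases hu : ν.toFun j with
    | none => exact hn.1
    | some u =>
      refine hn.2.2 u (fun hus => hjs (hus ▸ hu)) ?_ fun hr => ih hr hu
      simpa [hu] using hν.1 j

variable [Fintype S]

theorem GS_eq_some_iff {p : Problem I S} {i : I} {s : S} :
    (GS I S p).toFun i = some s ↔ i ∈ (gsState p (numSteps I S)).acc s :=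
  State.assignment_eq_some_iff fun _ _ _ hs ht =>
    (isNextChoice_of_mem_gsState_acc p _ hs).unique (isNextChoice_of_mem_gsState_acc p _ ht)

/-- A further step would accept or reject any applicant and so change a state that is stationary by
`gsStep_stop`. -/
theorem applicants_gsState_numSteps (p : Problem I S) (s : S) :
    applicants p (gsState p (numSteps I S)) s = ∅ := by
  classical
  refine Finset.eq_empty_of_forall_notMem fun i hi => ?_
  obtain ⟨hno, hn⟩ := mem_applicants.1 hi
  have hr : i ∈ (gsStep p (gsState p (numSteps I S))).rej s := by
    refine Finset.mem_union_right _ (Finset.mem_sdiff.2 ⟨?_, fun h => ?_⟩)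
    · exact Finset.mem_union_right _ hi
    · have h' : i ∈ (gsStep p (gsState p (numSteps I S))).acc s := by simpa [gsStep] using h
      rw [gsStep_stop] at h'
      exact hno s h'
  rw [gsStep_stop] at hr
  exact hn.2.1 hr

theorem individuallyRational_GS (p : Problem I S) : IndividuallyRational p (GS I S p) := by
  intro i
  cases h : (GS I S p).toFun i with
  | none => exact Or.inr rfl
  | some s => exact Or.inl (isNextChoice_of_mem_gsState_acc p _ (GS_eq_some_iff.1 h)).1

/-- A student has been rejected by every school that she prefers to her Gale-Shapley school. -/
theorem mem_rej_of_rel_GS {p : Problem I S} {i : I} {s : S}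
    (h : (p.P i).r (some s) ((GS I S p).toFun i)) : i ∈ (gsState p (numSteps I S)).rej s := by
  by_contra hr
  cases hi : (GS I S p).toFun i with
  | none =>
    rw [hi] at h
    obtain ⟨t, ht⟩ := exists_isNextChoice h hr
    have : i ∈ applicants p (gsState p (numSteps I S)) t := by
      refine mem_applicants.2 ⟨fun u hu => ?_, ht⟩
      rw [GS_eq_some_iff.2 hu] at hi
      cases hi
    simp [applicants_gsState_numSteps] at this
  | some t =>
    rw [hi] at h
    have hn := isNextChoice_of_mem_gsState_acc p _ (GS_eq_some_iff.1 hi)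
    have hst : s ≠ t := by
      rintro rfl
      exact (p.P i).irrefl _ h
    exact (p.P i).asymm h (hn.2.2 s hst ((p.P i).trans _ _ _ h hn.1) hr)

theorem stable_GS (p : Problem I S) : Stable p (GS I S p) := by
  classical
  refine ⟨individuallyRational_GS p, ?_⟩
  rintro ⟨i, s, hs, hb⟩
  obtain ⟨hfull, habove⟩ := gsState_rej_full p _ (mem_rej_of_rel_GS hs)
  rcases hb with ⟨j, hj, hij⟩ | hlt
  · exact (p.prio s).asymm hij (habove j (GS_eq_some_iff.1 hj))
  · refine absurd (hfull.trans (Finset.card_le_card fun j hj => ?_)) (not_le.2 hlt)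
    simpa using GS_eq_some_iff.2 hj

/-- The Gale-Shapley matching is student-optimal among the stable matchings. -/
theorem GS_optimal {p : Problem I S} {ν : Matching I p.q} (hν : Stable p ν) (i : I) :
    ¬ (p.P i).r (ν.toFun i) ((GS I S p).toFun i) := by
  intro h
  cases hi : ν.toFun i with
  | none =>
    rw [hi] at h
    rcases individuallyRational_GS p i with h' | h'
    · exact (p.P i).asymm h h'
    · exact (p.P i).irrefl _ (h' ▸ h)
  | some s =>
    rw [hi] at h
    exact gsState_rej_not_stable p hν _ (mem_rej_of_rel_GS h) hi

theorem card_matched {μ : I → Option S} [DecidableEq S]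
    [DecidablePred fun i => μ i ≠ none] :
    (Finset.univ.filter fun i => μ i ≠ none).card =
      ∑ s, (Finset.univ.filter fun i => μ i = some s).card := by
  classical
  rw [← Finset.card_biUnion]
  · congr 1
    ext i
    simp [Option.ne_none_iff_exists']
  · intro s _ t _ hst
    refine Finset.disjoint_left.2 fun i hs ht => hst ?_
    exact Option.some.inj ((Finset.mem_filter.1 hs).2.symm.trans (Finset.mem_filter.1 ht).2)

/-- The same students are unmatched in all stable matchings. -/
theorem GS_eq_none_iff {p : Problem I S} {ν : Matching I p.q} (hν : Stable p ν) (i : I) :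
    (GS I S p).toFun i = none ↔ ν.toFun i = none := by
  classical
  have hsub : (Finset.univ.filter fun i => ν.toFun i ≠ none) ⊆
      Finset.univ.filter fun i => (GS I S p).toFun i ≠ none := by
    intro j hj
    rw [Finset.mem_filter] at hj ⊢
    refine ⟨hj.1, fun h => GS_optimal hν j ?_⟩
    rw [h]
    exact (hν.1 j).resolve_right hj.2
  have hcard : (Finset.univ.filter fun i => (GS I S p).toFun i ≠ none).card ≤
      (Finset.univ.filter fun i => ν.toFun i ≠ none).card := by
    rw [card_matched, card_matched]
    refine Finset.sum_le_sum fun s _ => ?_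
    -- If `ν` leaves a seat free at `s`, a student whom `GS` newly places there would prefer `s` by
    -- optimality and block `ν`. If `s` is full under `ν`, the capacity bound suffices.
    by_cases hlt : (Finset.univ.filter fun i => ν.toFun i = some s).card < p.q s
    · refine Finset.card_le_card fun j hj => ?_
      rw [Finset.mem_filter] at hj ⊢
      refine ⟨hj.1, ?_⟩
      by_contra hne
      have hpref : (p.P j).r (some s) (ν.toFun j) :=
        ((p.P j).total _ _ hne).resolve_left fun h => GS_optimal hν j (hj.2 ▸ h)
      refine hν.2 ⟨j, s, hpref, Or.inr ?_⟩
      convert hlt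
    · refine le_trans ?_ (not_lt.1 hlt)
      convert (GS I S p).capacity s
  have heq := Finset.eq_of_subset_of_card_le hsub hcard
  have := congrArg (fun A => i ∈ A) heq
  simp only [Finset.mem_filter, Finset.mem_univ, true_and, eq_iff_iff] at this
  exact (not_iff_not.1 this).symm

end GaleShapley

/-- Stability is inherited by a preference profile under which the matching is individually
rational and no new school is preferred to the assigned one. -/
theorem Stable.of_rel {p : Problem I S} {μ : Matching I p.q} (hμ : Stable p μ)
    (P' : I → Ranking (Option S))
    (hir : ∀ i, (P' i).r (μ.toFun i) none ∨ μ.toFun i = none)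
    (hrel : ∀ i s, (P' i).r (some s) (μ.toFun i) → (p.P i).r (some s) (μ.toFun i)) :
    Stable ({ p with P := P' } : Problem I S) μ :=
  ⟨hir, fun ⟨i, s, hs, hb⟩ => hμ.2 ⟨i, s, hrel i s hs, hb⟩⟩

theorem Stable.misreport {p : Problem I S} {i : I} {Q Q' : Ranking (Option S)}
    {μ : Matching I p.q} (hμ : Stable (p.misreport i Q) μ)
    (hir : Q'.r (μ.toFun i) none ∨ μ.toFun i = none)
    (hrel : ∀ s, Q'.r (some s) (μ.toFun i) → Q.r (some s) (μ.toFun i)) :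
    Stable (p.misreport i Q') μ := by
  refine Stable.of_rel hμ (p.misreport i Q').P (fun j => ?_) fun j s => ?_
  · by_cases hj : j = i
    · subst hj; simpa using hir
    · rw [misreport_P_of_ne _ hj, ← misreport_P_of_ne p hj Q]
      exact hμ.1 j
  · by_cases hj : j = i
    · subst hj; simpa using hrel s
    · rw [misreport_P_of_ne _ hj, misreport_P_of_ne _ hj]
      exact id

/-! ### Strategy-proofness and the constrained Gale-Shapley mechanism. -/

variable [Fintype S]

/-- The Gale-Shapley mechanism is strategy-proof. -/
theorem notManipulable_GS (p : Problem I S) : NotManipulable (GS I S) p := by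
  classical
  rintro ⟨i, Q, h⟩
  obtain ⟨s, hs⟩ : ∃ s, (GS I S (p.misreport i Q)).toFun i = some s := by
    cases hi : (GS I S (p.misreport i Q)).toFun i with
    | some s => exact ⟨s, rfl⟩
    | none =>
      rw [hi] at h
      rcases individuallyRational_GS p i with h' | h'
      · exact absurd h' ((p.P i).asymm h)
      · exact absurd (h' ▸ h) ((p.P i).irrefl _)
  rw [hs] at h
  have hacc : (p.P i).r (some s) none := by
    rcases individuallyRational_GS p i with h' | h'
    · exact (p.P i).trans _ _ _ h h'
    · exact h' ▸ h
  -- `only` accepts just the school `s` gained by the lie; `upto` accepts `s` and everything that `P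
  -- i` ranks above it. The classes 0, 1, 2 stand for acceptable, outside option, unacceptable.
  let only : Ranking (Option S) := (p.P i).refineBy fun a =>
    if a = some s then 0 else if a = none then 1 else 2
  let upto : Ranking (Option S) := (p.P i).refineBy fun a =>
    if a = some s ∨ (p.P i).r a (some s) then 0 else if a = none then 1 else 2
  have hnone : ¬ (p.P i).r none (some s) := (p.P i).asymm hacc
  have hν : Stable (p.misreport i only) (GS I S (p.misreport i Q)) := by
    refine (stable_GS (p.misreport i Q)).misreport (Or.inl ?_) fun u => ?_
    · rw [hs]; left; simp
    · rw [hs]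
      intro hu
      by_cases hus : u = s
      · subst hus; exact absurd hu (only.irrefl _)
      · simp [only, Ranking.refineBy, hus] at hu
  -- If `upto` left `i` unmatched, its outcome would be stable under `only`, where another stable
  -- matching gives her `s`. So she gets some `t` at least as good as `s`, in a matching stable
  -- under the true `P i`.
  cases hl : (GS I S (p.misreport i upto)).toFun i with
  | none =>
    have hlam : Stable (p.misreport i only) (GS I S (p.misreport i upto)) := by
      refine (stable_GS (p.misreport i upto)).misreport (Or.inr hl) fun u => ?_
      rw [hl]
      intro hu
      by_cases hus : u = s
      · subst hus; left; simp [hnone]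
      · simp [only, Ranking.refineBy, hus] at hu
    have := (GS_eq_none_iff hν i).1 ((GS_eq_none_iff hlam i).2 hl)
    rw [hs] at this
    cases this
  | some t =>
    have hts : t = s ∨ (p.P i).r (some t) (some s) := by
      have := individuallyRational_GS (p.misreport i upto) i
      rw [hl] at this
      by_contra hn
      have hn' : ¬ (t = s) ∧ ¬ (p.P i).r (some t) (some s) := not_or.1 hn
      simp [upto, Ranking.refineBy, hnone, hn'.1, hn'.2] at this
    have htacc : (p.P i).r (some t) none := by
      rcases hts with rfl | hts
      · exact hacc
      · exact (p.P i).trans _ _ _ hts hacc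
    have hlam : Stable (p.misreport i (p.P i)) (GS I S (p.misreport i upto)) := by
      refine (stable_GS (p.misreport i upto)).misreport ?_ fun u => ?_
      · rw [hl]; exact Or.inl htacc
      · rw [hl]
        intro hu
        have hus : (p.P i).r (some u) (some s) := by
          rcases hts with rfl | hts
          · exact hu
          · exact (p.P i).trans _ _ _ hu hts
        right
        simp [hus, hts, hu]
    have hopt := GS_optimal hlam i
    rw [hl, misreport_self] at hopt
    rcases hts with rfl | hts
    · exact hopt h
    · exact hopt ((p.P i).trans _ _ _ hts h)

theorem Ranking.rel_of_trunc_rel {Q : Ranking (Option S)} {k : ℕ} {s : S} {a : Option S}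
    (h : (Q.trunc k).r (some s) a) : Q.r (some s) a := by
  cases a with
  | none => exact h.1
  | some t => exact h

theorem notManipulable_GS_constrained (p : Problem I S) (k : ℕ)
    (h : Stable p ((GS I S).constrained k p)) : NotManipulable ((GS I S).constrained k) p := by
  rintro ⟨i, Q, hQ⟩
  change (p.P i).r ((GS I S ((p.misreport i Q).trunc k)).toFun i)
    ((GS I S (p.trunc k)).toFun i) at hQ
  change Stable p (GS I S (p.trunc k)) at h
  rw [trunc_misreport p k i Q (p.P i)] at hQ
  -- Stability at `p` supplies the conditions for `i`; for the others, truncation only removes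
  -- preferred schools.
  have hμ : Stable ((p.trunc k).misreport i (p.P i)) (GS I S (p.trunc k)) := by
    refine h.of_rel ((p.trunc k).misreport i (p.P i)).P (fun j => ?_) fun j s => ?_
    · by_cases hj : j = i
      · subst hj; simpa using h.1 j
      · rw [misreport_P_of_ne _ hj]
        exact individuallyRational_GS (p.trunc k) j
    · by_cases hj : j = i
      · subst hj; simp
      · rw [misreport_P_of_ne _ hj]
        exact Ranking.rel_of_trunc_rel
  have hbest : ¬ (p.P i).r ((GS I S ((p.trunc k).misreport i (p.P i))).toFun i)
      ((GS I S (p.trunc k)).toFun i) := by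
    intro hlt
    cases hl : (GS I S ((p.trunc k).misreport i (p.P i))).toFun i with
    | none =>
      rw [hl] at hlt
      rcases h.1 i with h' | h'
      · exact (p.P i).asymm hlt h'
      · exact (p.P i).irrefl _ (h' ▸ hlt)
    | some t =>
      cases hv : (GS I S (p.trunc k)).toFun i with
      | none =>
        rw [(GS_eq_none_iff hμ i).2 hv] at hl
        cases hl
      | some v =>
        rw [hl, hv] at hlt
        have hvk : AmongFirst (p.P i) k v := by
          have := individuallyRational_GS (p.trunc k) i
          rw [hv] at this
          exact this.resolve_right (by simp)
        have hlam : Stable ((p.trunc k).misreport i ((p.trunc k).P i))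
            (GS I S ((p.trunc k).misreport i (p.P i))) := by
          refine (stable_GS ((p.trunc k).misreport i (p.P i))).misreport ?_ fun u => ?_
          · rw [hl]; exact Or.inl (hvk.of_above hlt)
          · exact Ranking.rel_of_trunc_rel
        have hopt := GS_optimal hlam i
        rw [hl, misreport_self, hv] at hopt
        exact hopt hlt
  refine notManipulable_GS ((p.trunc k).misreport i (p.P i)) ⟨i, Q.trunc k, ?_⟩
  rw [misreport_P_self]
  exact (p.P i).of_not_of_rel hbest hQ

end Algorithms

/-! ### Immediate acceptance: a blocking student gains by ranking the school first. -/

section Boston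

variable {I S : Type*} [Fintype I]

theorem bostonState_succ (p : Problem I S) (t : ℕ) :
    bostonState p (t + 1) = bostonStep p (bostonState p t) :=
  Function.iterate_succ_apply' _ _ _

theorem bostonState_acc_unique (p : Problem I S) (t : ℕ) (i : I) (s u : S)
    (hs : i ∈ (bostonState p t).acc s) (hu : i ∈ (bostonState p t).acc u) : s = u := by
  classical
  induction t generalizing s u with
  | zero => simp [bostonState, State.init] at hs
  | succ t ih =>
    rw [bostonState_succ] at hs hu
    rcases Finset.mem_union.1 hs with hs | hs <;> rcases Finset.mem_union.1 hu with hu | hu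
    · exact ih _ _ hs hu
    · exact absurd hs ((mem_applicants.1 (highest_subset _ _ _ hu)).1 s)
    · exact absurd hu ((mem_applicants.1 (highest_subset _ _ _ hs)).1 u)
    · exact (mem_applicants.1 (highest_subset _ _ _ hs)).2.unique
        (mem_applicants.1 (highest_subset _ _ _ hu)).2

theorem rel_none_of_mem_bostonState_acc (p : Problem I S) (t : ℕ) (i : I) (s : S)
    (hs : i ∈ (bostonState p t).acc s) : (p.P i).r (some s) none := by
  classical
  induction t with
  | zero => simp [bostonState, State.init] at hs
  | succ t ih =>
    rw [bostonState_succ] at hs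
    rcases Finset.mem_union.1 hs with hs | hs
    · exact ih hs
    · exact (mem_applicants.1 (highest_subset _ _ _ hs)).2.1

/-- The students accepted at the first step keep their seats. -/
theorem highest_subset_bostonState_acc (p : Problem I S) (t : ℕ) (s : S) :
    highest (p.prio s) (p.q s) (applicants p (State.init I S) s) ⊆
      (bostonState p (t + 1)).acc s := by
  classical
  induction t with
  | zero =>
    intro i hi
    rw [bostonState_succ]
    refine Finset.mem_union_right _ ?_
    simpa [bostonState, State.init] using hi
  | succ t ih =>
    rw [bostonState_succ]
    exact ih.trans Finset.subset_union_left

theorem mem_applicants_init {p : Problem I S} {i : I} {s : S} :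
    i ∈ applicants p (State.init I S) s ↔ (p.P i).r (some s) none ∧
      ∀ t, t ≠ s → (p.P i).r (some t) none → (p.P i).r (some s) (some t) := by
  rw [mem_applicants]
  simp [IsNextChoice, State.init]

variable [Fintype S]

theorem boston_eq_some_iff {p : Problem I S} {i : I} {s : S} :
    (boston I S p).toFun i = some s ↔ i ∈ (bostonState p (numSteps I S)).acc s :=
  State.assignment_eq_some_iff (bostonState_acc_unique p _)

/-- A student who has a justified claim to a seat at `s` under the Boston mechanism gets `s` by
ranking it first. -/
theorem boston_misreport_eq_some {p : Problem I S} {i : I} {s : S} {Q : Ranking (Option S)}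
    (hQ : ∀ a, a ≠ some s → Q.r (some s) a)
    (hb : (∃ j, (boston I S p).toFun j = some s ∧ (p.prio s).r i j) ∨
      ((bostonState p (numSteps I S)).acc s).card < p.q s) :
    (boston I S (p.misreport i Q)).toFun i = some s := by
  classical
  rw [boston_eq_some_iff]
  refine highest_subset_bostonState_acc (p.misreport i Q) _ s (mem_highest.2 ⟨?_, ?_⟩)
  · rw [mem_applicants_init, misreport_P_self]
    exact ⟨hQ none (by simp), fun t ht _ => hQ _ (by simpa using ht)⟩
  · by_contra hn
    -- First-step applications depend only on one's own report, so every rival of `i` already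
    -- applies to `s` at `p`.
    have hA : p.q s ≤ ((applicants p (State.init I S) s).filter
        fun j => (p.prio s).r j i).card := by
      refine (not_lt.1 hn).trans (Finset.card_le_card fun j hj => ?_)
      obtain ⟨hj, hji⟩ := Finset.mem_filter.1 hj
      have hne : j ≠ i := by
        rintro rfl
        exact Ranking.irrefl _ _ hji
      rw [mem_applicants_init, misreport_P_of_ne _ hne] at hj
      exact Finset.mem_filter.2 ⟨mem_applicants_init.2 hj, hji⟩
    obtain ⟨hfull, habove⟩ := highest_above hA
    -- `numSteps` is this product plus one, so the inclusion concerns the final state.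
    have hsub := highest_subset_bostonState_acc p (Fintype.card I * Fintype.card S) s
    rcases hb with ⟨j, hj, hij⟩ | hlt
    · have heq := Finset.eq_of_subset_of_card_le hsub
        ((card_bostonState_acc_le p _ s).trans hfull)
      have hj := boston_eq_some_iff.1 hj
      exact (p.prio s).asymm hij (habove j (heq ▸ hj))
    · exact absurd (hfull.trans (Finset.card_le_card hsub)) (not_le.2 hlt)

theorem stable_boston_constrained (p : Problem I S) {k : ℕ} (hk : 0 < k)
    (h : NotManipulable ((boston I S).constrained k) p) :
    Stable p ((boston I S).constrained k p) := by
  classical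
  refine ⟨fun i => ?_, ?_⟩
  · change (p.P i).r ((boston I S (p.trunc k)).toFun i) none ∨
      (boston I S (p.trunc k)).toFun i = none
    cases hi : (boston I S (p.trunc k)).toFun i with
    | none => exact Or.inr rfl
    | some s =>
      exact Or.inl (Ranking.rel_of_trunc_rel
        (rel_none_of_mem_bostonState_acc (p.trunc k) _ i s (boston_eq_some_iff.1 hi)))
  · rintro ⟨i, s, hs, hb⟩
    let Q : Ranking (Option S) := (p.P i).refineBy fun a => if a = some s then 0 else 1
    have hQ : ∀ a, a ≠ some s → Q.r (some s) a := fun a ha => by left; simp [ha]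
    refine h ⟨i, Q, ?_⟩
    have hmis : (boston I S ((p.misreport i Q).trunc k)).toFun i = some s := by
      have htr : (p.misreport i Q).trunc k = (p.trunc k).misreport i (Q.trunc k) := by
        rw [trunc_misreport p k i Q ((p.trunc k).P i), misreport_self]
      rw [htr]
      refine boston_misreport_eq_some ?_ (hb.imp id fun hlt => lt_of_le_of_lt ?_ hlt)
      · rintro (_ | t) ht
        · refine ⟨hQ none (by simp), ?_⟩
          -- No school lies above `s` in `Q`, so `s` survives the truncation.
          rw [Finset.card_eq_zero.2]
          · exact hk
          · refine Finset.filter_eq_empty_iff.2 fun t _ hts => ?_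
            by_cases hts' : t = s
            · subst hts'; exact Q.irrefl _ hts
            · exact Q.asymm hts (hQ _ (by simpa using hts'))
        · exact hQ _ ht
      · refine Finset.card_le_card fun j hj => Finset.mem_filter.2 ⟨Finset.mem_univ _, ?_⟩
        exact boston_eq_some_iff.2 hj
    change (p.P i).r ((boston I S ((p.misreport i Q).trunc k)).toFun i) _
    rw [hmis]
    exact hs

end Boston

end SchoolChoice

theorem mainTheorem5 {I S : Type*} [Fintype I] [Fintype S]
    (p : SchoolChoice.Problem I S) (k : ℕ) (hk : 1 < k) :
    (SchoolChoice.NotManipulable ((SchoolChoice.boston I S).constrained k) p →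
      SchoolChoice.Stable p ((SchoolChoice.boston I S).constrained k p)) ∧
    (SchoolChoice.Stable p ((SchoolChoice.GS I S).constrained k p) →
      SchoolChoice.NotManipulable ((SchoolChoice.GS I S).constrained k) p) :=
  ⟨SchoolChoice.stable_boston_constrained p (by omega),
    SchoolChoice.notManipulable_GS_constrained p k⟩
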